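/- Let $k$ be a field of characteristic different from $2$ and $3$, with algebraic closure $\bar k$, and let $S\in k[t]$ be a polynomial of degree $5$ or $6$ without repeated roots in $\bar k$. Let $\mathcal E$ be the elliptic curve $y^2=x^3+S(t)$ over $\bar k(t)$. For $f\in\bar k(t)$ let $\deg f$ be its degree as a rational map to $\mathbf P^1$ (the maximum of the degrees of numerator and denominator in lowest terms), and define the naive height $h$ on $\mathcal E(\bar k(t))$ by $h(0)=0$ and $h((x,y))=\max(\deg x,\tfrac23\deg y)$. The canonical height $\hat h(P)=\lim_{n\to\infty}4^{-n}h(2^nP)$ is the unique real-valued quadratic form on the group $\mathcal E(\bar k(t))$ for which $\hat h-h$ is bounded. Then: (i) for every $P\in\mathcal E(\bar k(t))$, $\hat h(P)$ is an even integer, and $\hat h(P)>0$ unless $P=0$; (ii) the points $P$ with $\hat h(P)=2$ are exactly the points $(x,y)$ given by the minimal solutions of $y^2=x^3+S$, that is, by polynomials $x,y\in\bar k[t]$ with $\deg x\le 2$, $\deg y\le 3$ and $y^2=x^3+S$; (iii) the torsion subgroup of $\mathcal E(\bar k(t))$ is trivial. -/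

import Mathlib

open Polynomial

namespace SexticSurface

/-- Equality of rational functions is decided classically; Mathlib's group law on the points of a
Weierstrass curve asks for such an instance. -/
noncomputable instance ratFuncDecidableEq (K : Type*) [Field K] : DecidableEq (RatFunc K) :=
  Classical.decEq _

/-- The curve `y² = x³ + S(t)` over the rational function field `K(t)`. -/
noncomputable def curve {K : Type*} [Field K] (S : K[X]) : WeierstrassCurve.Affine (RatFunc K) where
  a₁ := 0
  a₂ := 0
  a₃ := 0
  a₄ := 0
  a₆ := algebraMap K[X] (RatFunc K) S

/-- The degree of a rational function regarded as a rational map from the `t`-line to `ℙ¹`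
(constants have degree `0`). `num` and `denom` are coprime. -/
noncomputable def ratDegree {K : Type*} [Field K] (f : RatFunc K) : ℕ :=
  max f.num.natDegree f.denom.natDegree

/-- The naive height: `0` at the zero point and `max (deg x, (2/3) deg y)` at `(x, y)`. -/
noncomputable def naiveHeight {K : Type*} [Field K] {S : K[X]} : (curve S).Point → ℝ
  | .zero => 0
  | .some x y _ => max (ratDegree x : ℝ) (2 / 3 * (ratDegree y : ℝ))

/-- The two properties that characterize the canonical (Néron–Tate) height: it is a quadratic form
on the group of points, and it differs from the naive height by a bounded amount. -/
structure IsCanonicalHeight {K : Type*} [Field K] {S : K[X]} (g : (curve S).Point → ℝ) : Prop where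
  quadratic : ∃ Q : QuadraticMap ℤ (curve S).Point ℝ, ∀ P, Q P = g P
  bounded : ∃ C : ℝ, ∀ P, |g P - naiveHeight P| ≤ C

/-- The canonical height, as Tate's limit of `h(2ⁿ P) / 4ⁿ`. -/
noncomputable def canonicalHeight {K : Type*} [Field K] {S : K[X]} (P : (curve S).Point) : ℝ :=
  Filter.limUnder Filter.atTop fun n : ℕ => naiveHeight ((2 ^ n : ℕ) • P) / 4 ^ n

/-- A minimal solution of `y² = x³ + S`: polynomials of degree at most `2` and `3`. -/
structure IsMinimalSolution {K : Type*} [Field K] (S x y : K[X]) : Prop where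
  degree_x : x.natDegree ≤ 2
  degree_y : y.natDegree ≤ 3
  equation : y ^ 2 = x ^ 3 + S

end SexticSurface

namespace SexticSurface

/-! The canonical height turns out to be exactly `weightedHeight`, the degree of `(xNum : xDenom)`
with `xDenom` of weight 2. All claims then follow from elementary degree counts: it is even, at
least 2 off zero, and equal to 2 only at minimal solutions.

The exactness is the parallelogram law. `addSubForms` computes the symmetric functions of x(P + Q)
and x(P - Q) from x(P) and x(Q), so its values are proportional to `pointSymForms (P + Q) (P - Q)`.
Both families have no common zero on the projective line, so their degrees agree, by
`IsPrimitive.eq_of_proportional`. By `exists_addSubForms_ne_zero`, the first family could have a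
common zero only where the section meets the cusp of a fibre y² = x³. That never happens, since S,
as a sextic form, has only simple zeros: `eval_ne_zero_of_num_eval_eq_zero` and `coeff_six_ne_zero`.

Being quadratic and within 2 of the naive height, `weightedHeight` is Tate's limit. -/

/-! ### Families of polynomials without a common zero on the projective line -/

section Polynomials

variable {K : Type*} [Field K]

/-- `p` has degree at most `n`, and its coefficient in degree `n` is `a`; that is, `a` is the value
at infinity of `p` regarded as a form of degree `n`. -/
def HasTop (p : K[X]) (n : ℕ) (a : K) : Prop :=
  p.natDegree ≤ n ∧ p.coeff n = a

namespace HasTop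

variable {p q : K[X]} {m n : ℕ} {a b : K}

theorem mul (hp : HasTop p m a) (hq : HasTop q n b) : HasTop (p * q) (m + n) (a * b) :=
  ⟨natDegree_mul_le_of_le hp.1 hq.1, by rw [coeff_mul_add_eq_of_natDegree_le hp.1 hq.1, hp.2, hq.2]⟩

theorem pow (hp : HasTop p m a) (k : ℕ) : HasTop (p ^ k) (k * m) (a ^ k) :=
  ⟨natDegree_pow_le_of_le k hp.1, by rw [coeff_pow_of_natDegree_le hp.1, hp.2]⟩

theorem add (hp : HasTop p m a) (hq : HasTop q m b) : HasTop (p + q) m (a + b) :=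
  ⟨natDegree_add_le_of_degree_le hp.1 hq.1, by rw [coeff_add, hp.2, hq.2]⟩

theorem sub (hp : HasTop p m a) (hq : HasTop q m b) : HasTop (p - q) m (a - b) :=
  ⟨natDegree_sub_le_of_le hp.1 hq.1 |>.trans (max_self m).le, by rw [coeff_sub, hp.2, hq.2]⟩

theorem const_mul (c : K) (hp : HasTop p m a) : HasTop (C c * p) m (c * a) :=
  ⟨(natDegree_C_mul_le _ _).trans hp.1, by rw [coeff_C_mul, hp.2]⟩

theorem congr_degree (hp : HasTop p m a) (h : m = n) : HasTop p n a := h ▸ hp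

theorem natDegree_eq (hp : HasTop p m a) (ha : a ≠ 0) : p ≠ 0 ∧ p.natDegree = m := by
  have hc : p.coeff m ≠ 0 := by rwa [hp.2]
  exact ⟨fun h => hc (by simp [h]), le_antisymm hp.1 (le_natDegree_of_ne_zero hc)⟩

end HasTop

/-- Over an algebraically closed field, polynomials without a common zero generate the unit
ideal. -/
theorem exists_sum_mul_eq_one [IsAlgClosed K] {ι : Type*} [Fintype ι] {W : ι → K[X]}
    (hW : ∀ v, ∃ i, (W i).eval v ≠ 0) : ∃ u : ι → K[X], ∑ i, u i * W i = 1 := by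
  have htop : Ideal.span (Set.range W) = ⊤ := by
    by_contra h
    obtain ⟨M, hM, hle⟩ := Ideal.exists_le_maximal _ h
    obtain ⟨g, rfl⟩ : ∃ g, M = Ideal.span {g} := (IsPrincipalIdealRing.principal M).principal
    have hdvd : ∀ i, g ∣ W i := fun i =>
      Ideal.mem_span_singleton.1 (hle (Ideal.subset_span ⟨i, rfl⟩))
    have hg : g.degree ≠ 0 := fun h0 =>
      hM.ne_top (Ideal.span_singleton_eq_top.2 (isUnit_iff_degree_eq_zero.2 h0))
    obtain ⟨v, hv⟩ := IsAlgClosed.exists_root g hg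
    obtain ⟨i, hi⟩ := hW v
    exact hi (hv.dvd (hdvd i))
  have h1 : (1 : K[X]) ∈ Ideal.span (Set.range W) := htop ▸ Submodule.mem_top
  obtain ⟨u, hu⟩ := (Submodule.mem_span_range_iff_exists_fun _).1 h1
  exact ⟨u, by simpa using hu⟩

/-- A family of polynomials, the `i`-th one a form of degree `N - w i` on the projective line,
without a common zero on the projective line. -/
structure IsPrimitive {ι : Type*} (w : ι → ℕ) (W : ι → K[X]) (N : ℕ) : Prop where
  eval_ne_zero : ∀ v, ∃ i, (W i).eval v ≠ 0
  natDegree : (∀ i, W i ≠ 0 → (W i).natDegree + w i ≤ N) ∧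
    ∃ i, W i ≠ 0 ∧ (W i).natDegree + w i = N

/-- A Bézout relation for W gives a polynomial multiplier c with T = c W at an index where W attains
N, and multiplication by c ≠ 0 cannot lower the degree. -/
theorem IsPrimitive.le_of_proportional [IsAlgClosed K] {ι : Type*} [Fintype ι] {w : ι → ℕ}
    {W T : ι → K[X]} {N M : ℕ} (hW : IsPrimitive w W N) (hT : IsPrimitive w T M)
    (h : ∀ i j, W i * T j = W j * T i) : N ≤ M := by
  obtain ⟨u, hu⟩ := exists_sum_mul_eq_one hW.eval_ne_zero
  obtain ⟨j, hj, hjN⟩ := hW.natDegree.2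
  have hc : (∑ i, u i * T i) * W j = T j := by
    rw [← one_mul (T j), ← hu, Finset.sum_mul, Finset.sum_mul]
    exact Finset.sum_congr rfl fun i _ => by linear_combination (- u i) * h i j
  have hT0 : T j ≠ 0 := by
    intro h0
    obtain ⟨i, hi, -⟩ := hT.natDegree.2
    have := h j i
    rw [h0, mul_zero] at this
    exact (mul_ne_zero hj hi) this
  have hdeg : (W j).natDegree ≤ (T j).natDegree :=
    natDegree_le_of_dvd (Dvd.intro_left _ hc) hT0
  have := hT.natDegree.1 j hT0
  omega

theorem IsPrimitive.eq_of_proportional [IsAlgClosed K] {ι : Type*} [Fintype ι] {w : ι → ℕ}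
    {W T : ι → K[X]} {N M : ℕ} (hW : IsPrimitive w W N) (hT : IsPrimitive w T M)
    (h : ∀ i j, W i * T j = W j * T i) : N = M :=
  le_antisymm (hW.le_of_proportional hT h)
    (hT.le_of_proportional hW fun i j => by linear_combination - h i j)

-- The bound 4 ≤ N keeps the subtraction N - 2i from truncating for i ≤ 2.
theorem natDegree_of_hasTop {W : Fin 3 → K[X]} {N : ℕ} {b : Fin 3 → K} (hN : 4 ≤ N)
    (hW : ∀ i : Fin 3, HasTop (W i) (N - 2 * (i : ℕ)) (b i)) (hb : ∃ i, b i ≠ 0) :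
    (∀ i, W i ≠ 0 → (W i).natDegree + 2 * (i : ℕ) ≤ N) ∧
      ∃ i, W i ≠ 0 ∧ (W i).natDegree + 2 * (i : ℕ) = N := by
  refine ⟨fun i _ => ?_, ?_⟩
  · have := (hW i).1
    omega
  · obtain ⟨i, hi⟩ := hb
    obtain ⟨h0, h1⟩ := (hW i).natDegree_eq hi
    exact ⟨i, h0, by omega⟩

end Polynomials

/-! ### The sum and difference of two points on `y² = x³ + s` -/

/-- The forms that give `(x(P + Q) x(P - Q) : x(P + Q) + x(P - Q) : 1)` in terms of
`x(P) = (a₁ : z₁)` and `x(Q) = (a₂ : z₂)` on `y² = x³ + s`. -/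
def addSubForms {R : Type*} [CommRing R] (s a₁ z₁ a₂ z₂ : R) : Fin 3 → R :=
  ![(a₁ * a₂) ^ 2 - 4 * (s * (z₁ * z₂) * (a₁ * z₂ + a₂ * z₁)),
    2 * (a₁ * a₂ * (a₁ * z₂ + a₂ * z₁) + 2 * (s * (z₁ * z₂) ^ 2)),
    (a₁ * z₂ - a₂ * z₁) ^ 2]

/-- The elementary symmetric functions of `(a₁ : z₁)` and `(a₂ : z₂)`. -/
def symForms {R : Type*} [CommRing R] (a₁ z₁ a₂ z₂ : R) : Fin 3 → R :=
  ![a₁ * a₂, a₁ * z₂ + z₁ * a₂, z₁ * z₂]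

theorem map_symForms {R R' : Type*} [CommRing R] [CommRing R'] (f : R →+* R')
    (a₁ z₁ a₂ z₂ : R) (i : Fin 3) :
    f (symForms a₁ z₁ a₂ z₂ i) = symForms (f a₁) (f z₁) (f a₂) (f z₂) i := by
  fin_cases i <;> simp [symForms]

/-- These are the coefficients of a product of two nonzero linear forms. -/
theorem exists_symForms_ne_zero {F : Type*} [Field F] {a₁ z₁ a₂ z₂ : F} (h₁ : a₁ = 0 → z₁ ≠ 0)
    (h₂ : a₂ = 0 → z₂ ≠ 0) : ∃ i, symForms a₁ z₁ a₂ z₂ i ≠ 0 := by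
  by_contra! h
  have e0 : a₁ * a₂ = 0 := h 0
  have e1 : a₁ * z₂ + z₁ * a₂ = 0 := h 1
  have e2 : z₁ * z₂ = 0 := h 2
  rcases mul_eq_zero.1 e0 with h | h <;> rcases mul_eq_zero.1 e2 with h' | h' <;> simp_all

theorem map_addSubForms {R R' : Type*} [CommRing R] [CommRing R'] (f : R →+* R')
    (s a₁ z₁ a₂ z₂ : R) (i : Fin 3) :
    f (addSubForms s a₁ z₁ a₂ z₂ i) = addSubForms (f s) (f a₁) (f z₁) (f a₂) (f z₂) i := by
  fin_cases i <;> simp [addSubForms, map_ofNat]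

theorem addSubForms_homogeneous {F : Type*} [Field F] (s : F) {x₁ x₂ a₁ z₁ a₂ z₂ : F}
    (h₁ : a₁ = x₁ * z₁) (h₂ : a₂ = x₂ * z₂) (i : Fin 3) :
    addSubForms s a₁ z₁ a₂ z₂ i = (z₁ * z₂) ^ 2 * addSubForms s x₁ 1 x₂ 1 i := by
  subst h₁ h₂
  fin_cases i <;> simp [addSubForms] <;> ring

/-- Vanishing of the third form makes the two x-coordinates equal. The others become the denominator
a³ + s z³ and numerator a⁴ - 8 s a z³ of the duplication formula, whose common zeros satisfy 9a⁴ =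
0. What remains is the cusp a = s = 0. -/
theorem exists_addSubForms_ne_zero {F : Type*} [Field F] (h2 : (2 : F) ≠ 0) (h3 : (3 : F) ≠ 0)
    {s a₁ z₁ a₂ z₂ : F} (h₁ : a₁ = 0 → z₁ ≠ 0) (h₂ : a₂ = 0 → z₂ ≠ 0) (hs : a₁ = 0 → s ≠ 0) :
    ∃ i, addSubForms s a₁ z₁ a₂ z₂ i ≠ 0 := by
  by_contra! h
  have e0 : (a₁ * a₂) ^ 2 - 4 * (s * (z₁ * z₂) * (a₁ * z₂ + a₂ * z₁)) = 0 := h 0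
  have e1 : 2 * (a₁ * a₂ * (a₁ * z₂ + a₂ * z₁) + 2 * (s * (z₁ * z₂) ^ 2)) = 0 := h 1
  have e2 : a₁ * z₂ - a₂ * z₁ = 0 := pow_eq_zero_iff two_ne_zero |>.1 (h 2)
  by_cases hz : z₁ = 0
  · have ha : a₁ ≠ 0 := fun h0 => h₁ h0 hz
    have hz2 : z₂ = 0 := by simpa [hz, ha] using e2
    have ha2 : a₂ ≠ 0 := fun h0 => h₂ h0 hz2
    simp [hz, ha, ha2] at e0
  obtain ⟨c, rfl⟩ : ∃ c, z₂ = c * z₁ := ⟨z₂ / z₁, by field_simp⟩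
  have ha2 : a₂ = c * a₁ := mul_right_cancel₀ hz (by linear_combination - e2)
  subst ha2
  have hc : c ≠ 0 := by rintro rfl; simp at h₂
  have f1 : a₁ ^ 3 + s * z₁ ^ 3 = 0 := by
    have : (2 * 2 * c ^ 2 * z₁) * (a₁ ^ 3 + s * z₁ ^ 3) = 0 := by linear_combination e1
    simpa [h2, hc, hz] using this
  have f0 : a₁ ^ 4 - 8 * s * a₁ * z₁ ^ 3 = 0 := by
    have : c ^ 2 * (a₁ ^ 4 - 8 * s * a₁ * z₁ ^ 3) = 0 := by linear_combination e0
    simpa [hc] using this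
  have f2 : a₁ = 0 := by
    have : 3 ^ 2 * a₁ ^ 4 = 0 := by linear_combination f0 + 8 * a₁ * f1
    simpa [h3] using this
  exact hs f2 (by simpa [f2, hz] using f1)

section GroupLaw

open WeierstrassCurve.Affine

variable {F : Type*} [Field F] [DecidableEq F] {E : WeierstrassCurve.Affine F}

/-- For equal x-coordinates Q = ±P, and `sym2x` is symmetric, so both signs reduce to the
duplication formula. -/
theorem addSubForms_eq_mul_sym2x (h₁ : E.a₁ = 0) (h₂ : E.a₂ = 0) (h₃ : E.a₃ = 0) (h₄ : E.a₄ = 0)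
    (two : (2 : F) ≠ 0) {x₁ y₁ x₂ y₂ : F} (hP : E.Nonsingular x₁ y₁) (hQ : E.Nonsingular x₂ y₂) :
    ∃ c, ∀ i, addSubForms E.a₆ x₁ 1 x₂ 1 i =
      c * Point.sym2x (Point.some x₁ y₁ hP + Point.some x₂ y₂ hQ)
        (Point.some x₁ y₁ hP - Point.some x₂ y₂ hQ) i := by
  have key : ∀ {x y : F} (h : E.Nonsingular x y), ∃ c, ∀ i, addSubForms E.a₆ x 1 x 1 i =
      c * Point.sym2x (Point.some x y h + Point.some x y h) 0 i := by
    intro x y h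
    have e := (E.equation_iff x y).1 h.1
    simp only [h₁, h₂, h₃, h₄] at e
    by_cases hy : y = 0
    · rw [Point.add_self_of_Y_eq (by simp [negY, h₁, h₃, hy])]
      -- Here 2P = 0, so `sym2x` is (1, 0, 0) and the factor is the first form itself.
      refine ⟨x ^ 4 - 8 * E.a₆ * x, fun i => ?_⟩
      subst hy
      fin_cases i
      · simp [addSubForms]
        ring
      · simp only [addSubForms]
        simp
        exact Or.inr (by linear_combination (-2) * e)
      · simp [addSubForms]
    · have hy' : y ≠ E.negY x y := by
        intro h'
        simp only [negY, h₁, h₃] at h'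
        have : 2 * y = 0 := by linear_combination h'
        simp [two, hy] at this
      rw [Point.add_self_of_Y_ne hy', Point.sym2x_some_zero, slope_of_Y_ne rfl hy']
      refine ⟨4 * y ^ 2, fun i => ?_⟩
      have hd : y - E.negY x y = 2 * y := by simp [negY, h₁, h₃]; ring
      rw [hd]
      fin_cases i
      · simp [addSubForms, addX, h₁, h₂, h₄]
        field_simp
        linear_combination (32 * x) * e
      · simp [addSubForms]
        linear_combination (-4) * e
      · simp [addSubForms]
  by_cases hx : x₁ = x₂
  · rcases Point.X_eq_iff (h₁ := hP) (h₂ := hQ) |>.1 hx with h | h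
    · obtain ⟨c, hc⟩ := key hP
      subst hx
      exact ⟨c, fun i => by rw [hc, ← h, sub_self]⟩
    · obtain ⟨c, hc⟩ := key hP
      subst hx
      refine ⟨c, fun i => ?_⟩
      have h' : Point.some x₁ y₂ hQ = - Point.some x₁ y₁ hP := by rw [h, neg_neg]
      rw [hc, h', sub_neg_eq_add, add_neg_cancel, Point.sym2x_comm]
  · have e₁ := (E.equation_iff x₁ y₁).1 hP.1
    have e₂ := (E.equation_iff x₂ y₂).1 hQ.1
    simp only [h₁, h₂, h₃, h₄] at e₁ e₂
    have hd : x₁ - x₂ ≠ 0 := sub_ne_zero.2 hx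
    rw [sub_eq_add_neg, Point.neg_some, Point.add_of_X_ne hx, Point.add_of_X_ne hx,
      Point.sym2x_some_some, slope_of_X_ne hx, slope_of_X_ne hx]
    refine ⟨(x₁ - x₂) ^ 2, fun i => ?_⟩
    fin_cases i
    · simp [addSubForms, addX, negY, h₁, h₂, h₃]
      field_simp
      linear_combination
        (-(y₁ ^ 2 - y₂ ^ 2 + x₁ ^ 3 - x₂ ^ 3) + 2 * (x₁ + x₂) * (x₁ - x₂) ^ 2) * e₁
        + (y₁ ^ 2 - y₂ ^ 2 + x₁ ^ 3 - x₂ ^ 3 + 2 * (x₁ + x₂) * (x₁ - x₂) ^ 2) * e₂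
    · simp [addSubForms, addX, negY, h₁, h₂, h₃]
      field_simp
      linear_combination (-2) * e₁ -2 * e₂
    · simp [addSubForms]

end GroupLaw


/-! ### Numerators, denominators and their degrees -/

section Points

variable {K : Type*} [Field K] {S : K[X]}

theorem equation_curve_iff {x y : RatFunc K} :
    (curve S).Equation x y ↔ y ^ 2 = x ^ 3 + algebraMap K[X] (RatFunc K) S := by
  rw [WeierstrassCurve.Affine.equation_iff]
  simp [curve]

theorem nonsingular_curve_iff (h2 : (2 : K) ≠ 0) (h3 : (3 : K) ≠ 0) (hS : S ≠ 0)
    {x y : RatFunc K} :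
    (curve S).Nonsingular x y ↔ y ^ 2 = x ^ 3 + algebraMap K[X] (RatFunc K) S := by
  rw [← equation_curve_iff, WeierstrassCurve.Affine.equation_iff_nonsingular_of_Δ_ne_zero]
  have hS' : algebraMap K[X] (RatFunc K) S ≠ 0 := RatFunc.algebraMap_ne_zero hS
  have h2' : (2 : RatFunc K) ≠ 0 := by
    simpa only [map_ofNat] using (map_ne_zero (algebraMap K (RatFunc K))).2 h2
  have h3' : (3 : RatFunc K) ≠ 0 := by
    simpa only [map_ofNat] using (map_ne_zero (algebraMap K (RatFunc K))).2 h3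
  have hΔ : (curve S).Δ = -(2 ^ 4 * 3 ^ 3 * algebraMap K[X] (RatFunc K) S ^ 2) := by
    simp [WeierstrassCurve.Δ, WeierstrassCurve.b₂, WeierstrassCurve.b₄, WeierstrassCurve.b₆,
      WeierstrassCurve.b₈, curve]
    ring
  rw [hΔ]
  simp [h2', h3', hS']

theorem num_denom_equation {x y : RatFunc K} (h : (curve S).Nonsingular x y) :
    y.num ^ 2 * x.denom ^ 3 = y.denom ^ 2 * (x.num ^ 3 + S * x.denom ^ 3) := by
  have e := equation_curve_iff.1 h.1
  have hx : algebraMap K[X] (RatFunc K) x.denom ≠ 0 := RatFunc.algebraMap_ne_zero x.denom_ne_zero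
  have hy : algebraMap K[X] (RatFunc K) y.denom ≠ 0 := RatFunc.algebraMap_ne_zero y.denom_ne_zero
  apply RatFunc.algebraMap_injective K
  rw [← RatFunc.num_div_denom x, ← RatFunc.num_div_denom y] at e
  simp only [map_mul, map_pow, map_add]
  field_simp at e
  linear_combination e

/-- y² and x³ + S are the same fraction, and both expressions for it are in lowest terms. -/
theorem denom_pow_associated {x y : RatFunc K} (h : (curve S).Nonsingular x y) :
    Associated (y.denom ^ 2) (x.denom ^ 3) := by
  have e := num_denom_equation h
  have hx : IsCoprime (x.num ^ 3 + S * x.denom ^ 3) (x.denom ^ 3) :=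
    (IsCoprime.pow x.isCoprime_num_denom).add_mul_right_left S
  have hy : IsCoprime (y.num ^ 2) (y.denom ^ 2) := IsCoprime.pow y.isCoprime_num_denom
  refine associated_of_dvd_dvd ?_ ?_
  · exact hy.symm.dvd_of_dvd_mul_left ⟨_, e⟩
  · exact hx.symm.dvd_of_dvd_mul_right (Dvd.intro_left _ e)

theorem natDegree_denom {x y : RatFunc K} (h : (curve S).Nonsingular x y) :
    2 * y.denom.natDegree = 3 * x.denom.natDegree := by
  simpa using natDegree_eq_of_degree_eq (degree_eq_degree_of_associated (denom_pow_associated h))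

theorem natDegree_num {x y : RatFunc K} (h : (curve S).Nonsingular x y) :
    2 * y.num.natDegree = (x.num ^ 3 + S * x.denom ^ 3).natDegree := by
  have e := num_denom_equation h
  by_cases hy : y.num = 0
  · have : x.num ^ 3 + S * x.denom ^ 3 = 0 := by
      simpa [hy, y.denom_ne_zero] using e.symm
    simp [this, hy]
  have hx : x.num ^ 3 + S * x.denom ^ 3 ≠ 0 := by
    intro h0
    rw [h0, mul_zero] at e
    simp [hy, x.denom_ne_zero] at e
  have d := congrArg natDegree e
  rw [natDegree_mul (pow_ne_zero _ hy) (pow_ne_zero _ x.denom_ne_zero),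
    natDegree_mul (pow_ne_zero _ y.denom_ne_zero) hx, natDegree_pow, natDegree_pow, natDegree_pow,
    natDegree_denom h] at d
  omega

/-- A section does not pass through the singular point of a fibre `y² = x³` over an affine
point. -/
theorem eval_ne_zero_of_num_eval_eq_zero (hS : S.Separable) {x y : RatFunc K}
    (h : (curve S).Nonsingular x y) {v : K} (hv : x.num.eval v = 0) : S.eval v ≠ 0 := by
  intro hSv
  have hd : x.denom.eval v ≠ 0 := by
    obtain ⟨a, b, hab⟩ := x.isCoprime_num_denom
    intro h0
    simpa [hv, h0] using congrArg (eval v) hab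
  have hdy : y.denom.eval v ≠ 0 := by
    obtain ⟨c, hc⟩ := (denom_pow_associated h).dvd
    intro h0
    simpa [h0, hd] using congrArg (eval v) hc
  have e := num_denom_equation h
  have hny : y.num.eval v = 0 := by
    simpa [hv, hSv, hd] using congrArg (eval v) e
  have hS' : (derivative S).eval v ≠ 0 := by
    obtain ⟨a, b, hab⟩ := hS
    intro h0
    simpa [hSv, h0] using congrArg (eval v) hab
  -- The left side of `e` vanishes doubly at v, while the right side has derivative `y.denom² * S' *
  -- x.denom³` ≠ 0 there.
  have := congrArg (fun p => (derivative p).eval v) e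
  simp [derivative_mul, derivative_pow, hv, hSv, hny, hd, hdy, hS'] at this

/-- A section does not pass through the singular point of a fibre `y² = x³` over infinity. -/
theorem coeff_six_ne_zero (hdeg : S.natDegree = 5 ∨ S.natDegree = 6) {x y : RatFunc K}
    (h : (curve S).Nonsingular x y) (hx : x.num.natDegree < x.denom.natDegree + 2) :
    S.coeff 6 ≠ 0 := by
  have hS0 : S ≠ 0 := by rintro rfl; simp at hdeg
  rcases hdeg with hdeg | hdeg
  · exfalso
    -- In degree 5 the term `S * x.denom ^ 3` dominates; comparing numerator and denominator of y²
    -- would make 5 even.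
    have hlt : (x.num ^ 3).natDegree < (S * x.denom ^ 3).natDegree := by
      rw [natDegree_mul hS0 (pow_ne_zero _ x.denom_ne_zero), natDegree_pow, natDegree_pow]
      omega
    have e := natDegree_num h
    have e' := natDegree_denom h
    rw [natDegree_add_eq_right_of_natDegree_lt hlt,
      natDegree_mul hS0 (pow_ne_zero _ x.denom_ne_zero), natDegree_pow] at e
    omega
  · rw [← hdeg]
    exact leadingCoeff_ne_zero.2 hS0

/-! ### The height attached to the minimal model -/

/-- The numerator of the `x`-coordinate, with `x(0) = 1 / 0`. -/
noncomputable def xNum : (curve S).Point → K[X]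
  | .zero => 1
  | .some x _ _ => x.num

/-- The denominator of the `x`-coordinate, with `x(0) = 1 / 0`. -/
noncomputable def xDenom : (curve S).Point → K[X]
  | .zero => 0
  | .some x _ _ => x.denom

/-- The degree of the `x`-coordinate `(xNum : xDenom)` of a section, the denominator having
weight `2`. -/
noncomputable def weightedHeight : (curve S).Point → ℕ
  | .zero => 0
  | .some x _ _ => max x.num.natDegree (x.denom.natDegree + 2)

@[simp] theorem weightedHeight_zero : weightedHeight (0 : (curve S).Point) = 0 := rfl
@[simp] theorem xNum_zero : xNum (0 : (curve S).Point) = 1 := rfl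
@[simp] theorem xDenom_zero : xDenom (0 : (curve S).Point) = 0 := rfl

@[simp] theorem weightedHeight_neg (P : (curve S).Point) :
    weightedHeight (-P) = weightedHeight P := by
  cases P <;> rfl

/-- Whichever of `x.num` and `x.denom` determines the maximum, three times its degree is twice a
degree coming from y. -/
theorem even_weightedHeight (hdeg : S.natDegree = 5 ∨ S.natDegree = 6) (P : (curve S).Point) :
    Even (weightedHeight P) := by
  rcases P with _ | ⟨x, y, h⟩
  · exact Even.zero
  have e := natDegree_num h
  have e' := natDegree_denom h
  have hS0 : S ≠ 0 := by rintro rfl; simp at hdeg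
  rw [Nat.even_iff]
  change max x.num.natDegree (x.denom.natDegree + 2) % 2 = 0
  by_cases hlt : x.num.natDegree ≤ x.denom.natDegree + 2
  · rw [max_eq_right hlt]
    omega
  · have hlt : (S * x.denom ^ 3).natDegree < (x.num ^ 3).natDegree := by
      rw [natDegree_mul hS0 (pow_ne_zero _ x.denom_ne_zero), natDegree_pow, natDegree_pow]
      omega
    rw [natDegree_add_eq_left_of_natDegree_lt hlt, natDegree_pow] at e
    omega

theorem two_le_weightedHeight {P : (curve S).Point} (hP : P ≠ 0) : 2 ≤ weightedHeight P := by
  rcases P with _ | ⟨x, y, h⟩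
  · exact absurd rfl hP
  · exact le_max_of_le_right (Nat.le_add_left _ _)

theorem abs_weightedHeight_sub_naiveHeight_le (hdeg : S.natDegree = 5 ∨ S.natDegree = 6)
    (P : (curve S).Point) : |(weightedHeight P : ℝ) - naiveHeight P| ≤ 2 := by
  rcases P with _ | ⟨x, y, h⟩
  · simp [weightedHeight, naiveHeight]
  have e' := natDegree_denom h
  have e : 2 * y.num.natDegree ≤ 3 * max x.num.natDegree (x.denom.natDegree + 2) := by
    rw [natDegree_num h]
    refine (natDegree_add_le _ _).trans (max_le ?_ ?_)
    · rw [natDegree_pow]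
      omega
    · refine natDegree_mul_le.trans ?_
      rw [natDegree_pow]
      omega
  have hx : ratDegree x ≤ weightedHeight (.some x y h) := by
    simp only [ratDegree, weightedHeight]; omega
  have hx' : weightedHeight (.some x y h) ≤ ratDegree x + 2 := by
    simp only [ratDegree, weightedHeight]; omega
  have hy : 2 * ratDegree y ≤ 3 * weightedHeight (.some x y h) := by
    simp only [ratDegree, weightedHeight]; omega
  have hx : (ratDegree x : ℝ) ≤ weightedHeight (.some x y h) := by exact_mod_cast hx
  have hx' : (weightedHeight (.some x y h) : ℝ) ≤ ratDegree x + 2 := by exact_mod_cast hx'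
  have hy : (2 * ratDegree y : ℝ) ≤ 3 * weightedHeight (.some x y h) := by exact_mod_cast hy
  simp only [naiveHeight]
  rw [abs_le]
  constructor
  · have : max (ratDegree x : ℝ) (2 / 3 * ratDegree y) ≤ weightedHeight (.some x y h) :=
      max_le hx (by linarith)
    linarith
  · have := le_max_left (ratDegree x : ℝ) (2 / 3 * ratDegree y)
    linarith

theorem weightedHeight_eq_two (hdeg : S.natDegree = 5 ∨ S.natDegree = 6) {P : (curve S).Point}
    (hP : weightedHeight P = 2) :
    ∃ x y : K[X], IsMinimalSolution S x y ∧
      ∃ h : (curve S).Nonsingular (algebraMap K[X] (RatFunc K) x) (algebraMap K[X] (RatFunc K) y),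
        P = .some _ _ h := by
  rcases P with _ | ⟨x, y, h⟩
  · simp [weightedHeight] at hP
  have hP' : max x.num.natDegree (x.denom.natDegree + 2) = 2 := hP
  have e' := natDegree_denom h
  have hpoly : ∀ f : RatFunc K, f.denom.natDegree = 0 → f = algebraMap K[X] (RatFunc K) f.num := by
    intro f hf
    have h1 : f.denom = 1 := eq_one_of_monic_natDegree_zero f.monic_denom hf
    conv_lhs => rw [← f.num_div_denom, h1, map_one, div_one]
  have hx := hpoly x (by omega)
  have hy := hpoly y (by omega)
  have hydeg : 2 * y.num.natDegree ≤ 6 := by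
    rw [natDegree_num h]
    refine (natDegree_add_le _ _).trans (max_le ?_ ?_)
    · rw [natDegree_pow]
      omega
    · refine natDegree_mul_le.trans ?_
      rw [natDegree_pow]
      omega
  generalize x.num = p at *
  generalize y.num = q at *
  subst hx hy
  refine ⟨p, q, ⟨by omega, by omega, ?_⟩, h, rfl⟩
  apply RatFunc.algebraMap_injective K
  simpa using equation_curve_iff.1 h.1

theorem weightedHeight_of_isMinimalSolution {x y : K[X]} (hxy : IsMinimalSolution S x y)
    (h : (curve S).Nonsingular (algebraMap K[X] (RatFunc K) x) (algebraMap K[X] (RatFunc K) y)) :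
    weightedHeight (.some _ _ h) = 2 := by
  simpa [weightedHeight] using hxy.degree_x

/-! ### The parallelogram law -/

/-- The symmetric functions of the `x`-coordinates of two points. -/
noncomputable def pointSymForms (P Q : (curve S).Point) : Fin 3 → K[X] :=
  symForms (xNum P) (xDenom P) (xNum Q) (xDenom Q)

theorem pointSymForms_comm (P Q : (curve S).Point) : pointSymForms P Q = pointSymForms Q P := by
  funext i
  fin_cases i <;> simp [pointSymForms, symForms] <;> ring

theorem isCoprime_xNum_xDenom (P : (curve S).Point) : IsCoprime (xNum P) (xDenom P) := by
  rcases P with _ | ⟨x, y, h⟩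
  · exact isCoprime_one_left
  · exact x.isCoprime_num_denom

theorem xDenom_eval_ne_zero {P : (curve S).Point} {v : K} (hv : (xNum P).eval v = 0) :
    (xDenom P).eval v ≠ 0 := by
  obtain ⟨a, b, hab⟩ := isCoprime_xNum_xDenom P
  intro h0
  simpa [hv, h0] using congrArg (eval v) hab

theorem map_pointSymForms (P Q : (curve S).Point) :
    ∃ c, ∀ i, algebraMap K[X] (RatFunc K) (pointSymForms P Q i) = c * P.sym2x Q i := by
  have key : ∀ P : (curve S).Point, ∃ c, algebraMap K[X] (RatFunc K) (xNum P) = c * P.xRep 0 ∧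
      algebraMap K[X] (RatFunc K) (xDenom P) = c * P.xRep 1 := by
    rintro (_ | ⟨x, y, h⟩)
    · exact ⟨1, by simp [xNum, xDenom, WeierstrassCurve.Affine.Point.xRep]⟩
    · refine ⟨algebraMap K[X] (RatFunc K) x.denom, ?_, by simp [xDenom]⟩
      have hx : algebraMap K[X] (RatFunc K) x.denom ≠ 0 :=
        RatFunc.algebraMap_ne_zero x.denom_ne_zero
      have := x.num_div_denom
      rw [div_eq_iff hx] at this
      simpa [xNum, mul_comm] using this
  obtain ⟨c, hc, hc'⟩ := key P
  obtain ⟨d, hd, hd'⟩ := key Q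
  refine ⟨c * d, fun i => ?_⟩
  fin_cases i <;> simp [pointSymForms, symForms, WeierstrassCurve.Affine.Point.sym2x, hc, hc', hd, hd'] <;> ring

/-- Both families are multiples of the same `sym2x` vector over K(t), so their 2 × 2 minors vanish.
-/
theorem addSubForms_mul_pointSymForms (h2 : (2 : K) ≠ 0) {P Q : (curve S).Point} (hP : P ≠ 0)
    (hQ : Q ≠ 0) (i j : Fin 3) :
    addSubForms S (xNum P) (xDenom P) (xNum Q) (xDenom Q) i * pointSymForms (P + Q) (P - Q) j =
      addSubForms S (xNum P) (xDenom P) (xNum Q) (xDenom Q) j * pointSymForms (P + Q) (P - Q) i := by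
  obtain ⟨d, hd⟩ := map_pointSymForms (P + Q) (P - Q)
  have h2' : (2 : RatFunc K) ≠ 0 := by
    simpa only [map_ofNat] using (map_ne_zero (algebraMap K (RatFunc K))).2 h2
  rcases P with _ | ⟨x₁, y₁, h₁⟩
  · exact absurd rfl hP
  rcases Q with _ | ⟨x₂, y₂, h₂⟩
  · exact absurd rfl hQ
  obtain ⟨c, hc⟩ := addSubForms_eq_mul_sym2x (E := curve S) rfl rfl rfl rfl h2' h₁ h₂
  have hnum : ∀ x : RatFunc K, algebraMap K[X] (RatFunc K) x.num =
      x * algebraMap K[X] (RatFunc K) x.denom := fun x =>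
    (div_eq_iff (RatFunc.algebraMap_ne_zero x.denom_ne_zero)).1 x.num_div_denom
  apply RatFunc.algebraMap_injective K
  simp only [map_mul, map_addSubForms, hd, xNum, xDenom,
    addSubForms_homogeneous _ (hnum x₁) (hnum x₂)]
  have hc' : ∀ i, addSubForms (algebraMap K[X] (RatFunc K) S) x₁ 1 x₂ 1 i = _ := hc
  simp only [hc']
  ring

/-- Here (a : z) is the value of the x-coordinate at infinity; the last clause supplies the
hypothesis of `coeff_six_ne_zero` when a = 0. -/
theorem hasTop_point {P : (curve S).Point} (hP : P ≠ 0) :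
    ∃ (m : ℕ) (a z : K), weightedHeight P = m + 2 ∧ HasTop (xNum P) (m + 2) a ∧
      HasTop (xDenom P) m z ∧ (a = 0 → z ≠ 0) ∧
      (a = 0 → (xNum P).natDegree < (xDenom P).natDegree + 2) := by
  rcases P with _ | ⟨x, y, h⟩
  · exact absurd rfl hP
  obtain ⟨m, hm⟩ := Nat.exists_eq_add_of_le' (two_le_weightedHeight hP)
  have hm' : max x.num.natDegree (x.denom.natDegree + 2) = m + 2 := hm
  simp only [xNum, xDenom]
  have key : x.num.coeff (m + 2) = 0 → x.num.natDegree < m + 2 := by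
    intro h0
    refine lt_of_le_of_ne (by omega) fun h' => ?_
    rw [← h', coeff_natDegree, leadingCoeff_eq_zero] at h0
    simp [h0] at h'
  refine ⟨m, _, _, hm, ⟨by omega, rfl⟩, ⟨by omega, rfl⟩, fun h0 => ?_, fun h0 => ?_⟩
  · have h1 := key h0
    have : x.denom.natDegree = m := by omega
    rw [← this]
    exact leadingCoeff_ne_zero.2 x.denom_ne_zero
  · have h1 := key h0
    omega

theorem isPrimitive_pointSymForms (P Q : (curve S).Point) :
    IsPrimitive (fun i : Fin 3 => 2 * (i : ℕ)) (pointSymForms P Q)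
      (weightedHeight P + weightedHeight Q) := by
  refine ⟨fun v => ?_, ?_⟩
  · obtain ⟨i, hi⟩ := exists_symForms_ne_zero (xDenom_eval_ne_zero (P := P) (v := v))
      (xDenom_eval_ne_zero (P := Q) (v := v))
    refine ⟨i, ?_⟩
    rwa [← coe_evalRingHom, pointSymForms, map_symForms]
  -- The zero point is treated apart: its weight is 0, not of the form m + 2.
  have key : ∀ Q : (curve S).Point,
      (∀ i, pointSymForms 0 Q i ≠ 0 →
        (pointSymForms 0 Q i).natDegree + 2 * (i : ℕ) ≤ weightedHeight Q) ∧
      ∃ i, pointSymForms 0 Q i ≠ 0 ∧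
        (pointSymForms 0 Q i).natDegree + 2 * (i : ℕ) = weightedHeight Q := by
    intro Q
    have hzero : pointSymForms 0 Q = ![xNum Q, xDenom Q, 0] := by
      funext i
      fin_cases i <;> simp [pointSymForms, symForms]
    rw [hzero]
    by_cases hQ : Q = 0
    · subst hQ
      refine ⟨fun i hi => ?_, 0, by simp⟩
      fin_cases i <;> simp at hi ⊢
    obtain ⟨m, a, z, hm, ha, hz, haz, -⟩ := hasTop_point hQ
    rw [hm]
    refine ⟨fun i hi => ?_, ?_⟩
    · fin_cases i
      · simpa using ha.1
      · simpa using hz.1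
      · simp at hi
    · by_cases h0 : a = 0
      · exact ⟨1, by simpa using hz.natDegree_eq (haz h0)⟩
      · exact ⟨0, by simpa using ha.natDegree_eq h0⟩
  by_cases hP : P = 0
  · simpa [hP] using key Q
  by_cases hQ : Q = 0
  · simpa [hQ, pointSymForms_comm P] using key P
  obtain ⟨m, a, z, hm, ha, hz, haz, -⟩ := hasTop_point hP
  obtain ⟨n, b, y, hn, hb, hy, hby, -⟩ := hasTop_point hQ
  have htop : ∀ i : Fin 3, HasTop (pointSymForms P Q i) (m + 2 + (n + 2) - 2 * (i : ℕ))
      (symForms a z b y i) := by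
    intro i
    fin_cases i
    · exact (ha.mul hb).congr_degree (by simp)
    · exact ((ha.mul hy).congr_degree (by simp; omega)).add
        ((hz.mul hb).congr_degree (by simp; omega))
    · exact (hz.mul hy).congr_degree (by simp; omega)
  rw [hm, hn]
  exact natDegree_of_hasTop (by omega) htop (exists_symForms_ne_zero haz hby)

theorem isPrimitive_addSubForms (h2 : (2 : K) ≠ 0) (h3 : (3 : K) ≠ 0)
    (hdeg : S.natDegree = 5 ∨ S.natDegree = 6) (hS : S.Separable) {P Q : (curve S).Point}
    (hP : P ≠ 0) (hQ : Q ≠ 0) :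
    IsPrimitive (fun i : Fin 3 => 2 * (i : ℕ))
      (addSubForms S (xNum P) (xDenom P) (xNum Q) (xDenom Q))
      (2 * weightedHeight P + 2 * weightedHeight Q) := by
  refine ⟨fun v => ?_, ?_⟩
  · obtain ⟨i, hi⟩ := exists_addSubForms_ne_zero h2 h3 (xDenom_eval_ne_zero (P := P) (v := v))
      (xDenom_eval_ne_zero (P := Q) (v := v)) (s := S.eval v) (fun hv => by
        rcases P with _ | ⟨x, y, h⟩
        · exact absurd rfl hP
        · exact eval_ne_zero_of_num_eval_eq_zero hS h hv)
    refine ⟨i, ?_⟩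
    rwa [← coe_evalRingHom, map_addSubForms]
  obtain ⟨m, a, z, hm, ha, hz, haz, hlt⟩ := hasTop_point hP
  obtain ⟨n, b, y, hn, hb, hy, hby, -⟩ := hasTop_point hQ
  -- S counts as a form of degree 6; when its degree is 5, infinity is one of its zeros.
  have hs : HasTop S 6 (S.coeff 6) := ⟨by omega, rfl⟩
  have hsum : HasTop (xNum P * xDenom Q + xNum Q * xDenom P) (m + n + 2) (a * y + b * z) :=
    ((ha.mul hy).congr_degree (by omega)).add ((hb.mul hz).congr_degree (by omega))
  have hdiff : HasTop (xNum P * xDenom Q - xNum Q * xDenom P) (m + n + 2) (a * y - b * z) :=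
    ((ha.mul hy).congr_degree (by omega)).sub ((hb.mul hz).congr_degree (by omega))
  have htop : ∀ i : Fin 3,
      HasTop (addSubForms S (xNum P) (xDenom P) (xNum Q) (xDenom Q) i)
        (2 * (m + 2) + 2 * (n + 2) - 2 * (i : ℕ)) (addSubForms (S.coeff 6) a z b y i) := by
    intro i
    fin_cases i
    · exact (((ha.mul hb).pow 2).congr_degree (by simp; omega)).sub
        ((((hs.mul (hz.mul hy)).mul hsum).const_mul 4).congr_degree (by simp; omega))
    · exact ((((ha.mul hb).mul hsum).congr_degree (by simp; omega)).add
        (((hs.mul ((hz.mul hy).pow 2)).const_mul 2).congr_degree (by simp; omega))).const_mul 2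
    · exact (hdiff.pow 2).congr_degree (by simp; omega)
  rw [hm, hn]
  refine natDegree_of_hasTop (by omega) htop
    (exists_addSubForms_ne_zero h2 h3 haz hby fun h0 => ?_)
  rcases P with _ | ⟨x, y, h⟩
  · exact absurd rfl hP
  · exact coeff_six_ne_zero hdeg h (hlt h0)

theorem weightedHeight_parallelogram [IsAlgClosed K] (h2 : (2 : K) ≠ 0) (h3 : (3 : K) ≠ 0)
    (hdeg : S.natDegree = 5 ∨ S.natDegree = 6) (hS : S.Separable) (P Q : (curve S).Point) :
    weightedHeight (P + Q) + weightedHeight (P - Q) =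
      2 * weightedHeight P + 2 * weightedHeight Q := by
  by_cases hP : P = 0
  · simp [hP, two_mul]
  by_cases hQ : Q = 0
  · simp [hQ, two_mul]
  exact ((isPrimitive_addSubForms h2 h3 hdeg hS hP hQ).eq_of_proportional
    (isPrimitive_pointSymForms _ _) (addSubForms_mul_pointSymForms h2 hP hQ)).symm

end Points

/-! ### Functions that satisfy the parallelogram law -/

section Quadratic

variable {A : Type*} [AddCommGroup A] {f : A → ℝ}

/-- The Jordan–von Neumann argument: biadditivity is a linear combination of instances of the law.
-/
theorem polar_add_left_of_parallelogram
    (hf : ∀ a b, f (a + b) + f (a - b) = 2 * f a + 2 * f b) (a b c : A) :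
    QuadraticMap.polar f (a + b) c = QuadraticMap.polar f a c + QuadraticMap.polar f b c := by
  have e₁ := hf (a + c) b
  have e₂ := hf (a - c) b
  have e₃ := hf a (b + c)
  have e₄ := hf a (b - c)
  have e₅ := hf (a + b) c
  have e₆ := hf a c
  have e₇ := hf b c
  have e₈ := hf a b
  rw [show a + c + b = a + b + c by abel, show a + c - b = a - (b - c) by abel] at e₁
  rw [show a - c + b = a + (b - c) by abel, show a - c - b = a - (b + c) by abel] at e₂
  rw [show a + (b + c) = a + b + c by abel] at e₃
  rw [show a + b - c = a + (b - c) by abel] at e₅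
  simp only [QuadraticMap.polar]
  linarith

theorem exists_quadraticMap_of_parallelogram
    (hf : ∀ a b, f (a + b) + f (a - b) = 2 * f a + 2 * f b) :
    ∃ Q : QuadraticMap ℤ A ℝ, ∀ a, Q a = f a := by
  have h0 : f 0 = 0 := by
    have := hf 0 0
    simp only [add_zero, sub_zero] at this
    linarith
  have hneg : ∀ a, f (-a) = f a := fun a => by
    have := hf 0 a
    simp only [zero_add, zero_sub] at this
    linarith
  have hadd := polar_add_left_of_parallelogram hf
  have hsmul : ∀ (n : ℤ) (a b : A),
      QuadraticMap.polar f (n • a) b = n • QuadraticMap.polar f a b := fun n a b =>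
    map_zsmul (AddMonoidHom.mk' (fun a => QuadraticMap.polar f a b) fun a a' => hadd a a' b) n a
  have hself : ∀ a, QuadraticMap.polar f a a = 2 * f a := fun a => by
    have := hf a a
    rw [sub_self, h0] at this
    simp only [QuadraticMap.polar]
    linarith
  refine ⟨QuadraticMap.ofPolar f (fun n a => ?_) hadd hsmul, fun a => rfl⟩
  have e₁ := hself (n • a)
  rw [hsmul, QuadraticMap.polar_comm, hsmul, hself] at e₁
  simp only [zsmul_eq_mul, Int.cast_mul] at e₁ ⊢
  linarith

end Quadratic

/-! ### Uniqueness of the canonical height, and torsion -/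

section CanonicalHeight

variable {K : Type*} [Field K] {S : K[X]}

open Filter Topology in
theorem IsCanonicalHeight.eq_canonicalHeight {g : (curve S).Point → ℝ} (hg : IsCanonicalHeight g) :
    g = canonicalHeight := by
  obtain ⟨⟨Q, hQ⟩, C, hC⟩ := hg
  funext P
  refine (Tendsto.limUnder_eq ?_).symm
  -- Quadraticity turns the bound C at 2ⁿP into the bound C / 4ⁿ at P.
  have hmul : ∀ n : ℕ, g ((2 ^ n : ℕ) • P) = 4 ^ n * g P := fun n => by
    have := Q.map_smul ((2 ^ n : ℕ) : ℤ) P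
    rw [natCast_zsmul, hQ, hQ] at this
    rw [this, zsmul_eq_mul]
    push_cast
    rw [← mul_pow]
    norm_num
  have hlim : Tendsto (fun n : ℕ => C / 4 ^ n) atTop (𝓝 0) :=
    tendsto_const_nhds.div_atTop (tendsto_pow_atTop_atTop_of_one_lt (by norm_num))
  rw [tendsto_iff_norm_sub_tendsto_zero]
  refine squeeze_zero (fun n => norm_nonneg _) (fun n => ?_) hlim
  have h4 : (0 : ℝ) < 4 ^ n := by positivity
  rw [Real.norm_eq_abs, le_div_iff₀ h4, ← abs_of_pos h4, ← abs_mul, abs_of_pos h4, sub_mul,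
    div_mul_cancel₀ _ h4.ne', abs_sub_comm, mul_comm (g P), ← hmul]
  exact hC _

theorem isCanonicalHeight_weightedHeight [IsAlgClosed K] (h2 : (2 : K) ≠ 0) (h3 : (3 : K) ≠ 0)
    (hdeg : S.natDegree = 5 ∨ S.natDegree = 6) (hS : S.Separable) :
    IsCanonicalHeight fun P : (curve S).Point => (weightedHeight P : ℝ) :=
  ⟨exists_quadraticMap_of_parallelogram fun P Q => by
    exact_mod_cast weightedHeight_parallelogram h2 h3 hdeg hS P Q,
    2, abs_weightedHeight_sub_naiveHeight_le hdeg⟩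

/-- If nP = 0 with n > 0, then n² g(P) = 0, against positivity. -/
theorem torsion_eq_bot_of_isCanonicalHeight {g : (curve S).Point → ℝ} (hg : IsCanonicalHeight g)
    (hpos : ∀ P, P ≠ 0 → 0 < g P) : AddCommGroup.torsion (curve S).Point = ⊥ := by
  obtain ⟨⟨Q, hQ⟩, -⟩ := hg
  rw [eq_bot_iff]
  intro P hP
  obtain ⟨n, hn, hnP⟩ := isOfFinAddOrder_iff_nsmul_eq_zero.1 hP
  by_contra h
  have e := Q.map_smul (n : ℤ) P
  rw [natCast_zsmul, hnP, Q.map_zero, hQ, zsmul_eq_mul] at e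
  have hn' : (0 : ℝ) < n := by exact_mod_cast hn
  have := hpos P h
  push_cast at e
  exact absurd e (by positivity)

end CanonicalHeight
end SexticSurface

/-! ### The theorem over the algebraic closure -/

open SexticSurface in
theorem mainTheorem7 {k K : Type*} [Field k] [Field K] [Algebra k K] [IsAlgClosure k K]
    (h2 : (2 : k) ≠ 0) (h3 : (3 : k) ≠ 0)
    (S : k[X]) (hdeg : S.natDegree = 5 ∨ S.natDegree = 6) (hS : S.Separable) :
    -- the canonical height on the group of `K(t)`-points exists and is unique
    (IsCanonicalHeight (canonicalHeight : (curve (S.map (algebraMap k K))).Point → ℝ) ∧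
      ∀ g : (curve (S.map (algebraMap k K))).Point → ℝ, IsCanonicalHeight g → g = canonicalHeight) ∧
    -- (i)
    (∀ P : (curve (S.map (algebraMap k K))).Point, (∃ m : ℤ, Even m ∧ canonicalHeight P = m) ∧
      (P ≠ 0 → 0 < canonicalHeight P)) ∧
    -- (ii)
    ((∀ P : (curve (S.map (algebraMap k K))).Point, canonicalHeight P = 2 →
        ∃ x y : K[X], IsMinimalSolution (S.map (algebraMap k K)) x y ∧
          ∃ h : (curve (S.map (algebraMap k K))).Nonsingular (algebraMap K[X] (RatFunc K) x)
              (algebraMap K[X] (RatFunc K) y),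
            P = .some _ _ h) ∧
      (∀ x y : K[X], IsMinimalSolution (S.map (algebraMap k K)) x y →
        ∃ h : (curve (S.map (algebraMap k K))).Nonsingular (algebraMap K[X] (RatFunc K) x)
            (algebraMap K[X] (RatFunc K) y),
          canonicalHeight (.some _ _ h) = 2)) ∧
    -- (iii)
    AddCommGroup.torsion (curve (S.map (algebraMap k K))).Point = ⊥ := by
  have : IsAlgClosed K := IsAlgClosure.isAlgClosed k
  replace h2 : (2 : K) ≠ 0 := by
    simpa only [map_ofNat] using (map_ne_zero (algebraMap k K)).2 h2
  replace h3 : (3 : K) ≠ 0 := by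
    simpa only [map_ofNat] using (map_ne_zero (algebraMap k K)).2 h3
  -- Degree and separability survive the base change, so k can be forgotten.
  rw [← natDegree_map (algebraMap k K)] at hdeg
  replace hS : (S.map (algebraMap k K)).Separable := hS.map
  generalize S.map (algebraMap k K) = S at *
  have hcan := isCanonicalHeight_weightedHeight h2 h3 hdeg hS
  have heq := hcan.eq_canonicalHeight
  have hpos : ∀ P : (curve S).Point, P ≠ 0 → (0 : ℝ) < weightedHeight P := fun P hP => by
    exact_mod_cast two_pos.trans_le (two_le_weightedHeight hP)
  refine ⟨⟨heq ▸ hcan, fun g hg => hg.eq_canonicalHeight⟩, ?_⟩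
  rw [← heq]
  refine ⟨fun P => ⟨⟨weightedHeight P, ?_, by simp⟩, hpos P⟩,
    ⟨fun P hP => weightedHeight_eq_two hdeg (Nat.cast_injective (R := ℝ) hP), fun x y hxy => ?_⟩,
    torsion_eq_bot_of_isCanonicalHeight hcan hpos⟩
  · exact_mod_cast even_weightedHeight hdeg P
  · refine ⟨(nonsingular_curve_iff h2 h3 hS.ne_zero).2 ?_, ?_⟩
    · rw [← map_pow, hxy.equation, map_add, map_pow]
    · exact congrArg (Nat.cast (R := ℝ)) (weightedHeight_of_isMinimalSolution hxy _)
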